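/- Configurations over a finite alphabet $\Sigma$ are the elements of $\Sigma^{\mathbb Z}$. A pattern is a map $P$ from a finite domain $D_P\subseteq\mathbb Z$ to $\Sigma$; it appears in a configuration $c$ if for some $v\in\mathbb Z$ we have $c(v+x)=P(x)$ for all $x\in D_P$, and it appears in a pattern $M$ if for some $v\in\mathbb Z$ we have $v+D_P\subseteq D_M$ and $M(v+x)=P(x)$ for all $x\in D_P$. A 1-dimensional effective subshift is the set of all configurations in which no word from some recursively enumerable set of finite words over $\Sigma$ appears (a word $w$ being a pattern of domain $\{0,\dots,|w|-1\}$). A configuration $c$ is quasi-periodic if for every pattern $P$ that appears in $c$ there is $n\in\mathbb N$ such that $P$ appears in every pattern of domain $\{-n,\dots,n\}$ that appears in $c$. Its quasi-periodicity function $\mathcal Q_c:\mathbb N\to\mathbb N$ maps $n$ to the smallest $m$ such that every pattern of domain $\{-n,\dots,n\}$ that appears in $c$ appears in every pattern of domain $\{-m,\dots,m\}$ that appears in $c$. **Theorem.** For every partial computable function $\varphi:\mathbb N\rightharpoonup\mathbb N$ there exist a finite alphabet $\Sigma$ and a non-empty 1-dimensional effective subshift $X_\varphi\subseteq\Sigma^{\mathbb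 Z}$ such that every quasi-periodic configuration $c\in X_\varphi$ satisfies $\mathcal Q_c(n)\ge\varphi(n)$ for every $n$ for which $\varphi(n)$ is defined. -/

import Mathlib

namespace QuasiPeriodicity

/-- A one-dimensional pattern over the alphabet `A`: a map from a finite domain in `ℤ` to `A`. -/
structure Pattern (A : Type) where
  domain : Finset ℤ
  val : domain → A

/-- `P` appears in the configuration `c`: some shift of `c` agrees with `P` on the domain
of `P`. -/
def Pattern.AppearsIn {A : Type} (P : Pattern A) (c : ℤ → A) : Prop :=
  ∃ v : ℤ, ∀ x : P.domain, c (v + x) = P.val x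

/-- `P` appears in the pattern `M`: some translate of the domain of `P` lies in the domain of `M`,
and `M` agrees with `P` there. -/
def Pattern.AppearsInPattern {A : Type} (P M : Pattern A) : Prop :=
  ∃ v : ℤ, ∀ x : P.domain, ∃ h : v + (x : ℤ) ∈ M.domain, M.val ⟨v + x, h⟩ = P.val x

/-- A finite word, seen as a pattern of domain `[0; |w| - 1]`. -/
noncomputable def Pattern.ofWord {A : Type} (w : List A) : Pattern A where
  domain := Finset.Ico 0 (w.length : ℤ)
  val x := w[(x : ℤ).toNat]'(by
    have hx := Finset.mem_Ico.mp x.2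
    omega)

/-- The set of configurations in which no pattern of `F` appears. -/
def validConfigurations {A : Type} (F : Set (Pattern A)) : Set (ℤ → A) :=
  {c | ∀ P ∈ F, ¬ P.AppearsIn c}

/-- A one-dimensional effective subshift: the set of configurations avoiding a recursively
enumerable set of forbidden words. -/
def IsEffectiveSubshift {k : ℕ} (X : Set (ℤ → Fin k)) : Prop :=
  ∃ W : Set (List (Fin k)), REPred (fun w => w ∈ W) ∧
    X = validConfigurations (Pattern.ofWord '' W)

/-- `c` is quasi-periodic: every pattern that appears in `c` appears in every pattern of `c` of
domain `[-n; n]`, for some `n`. -/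
def IsQuasiPeriodic {A : Type} (c : ℤ → A) : Prop :=
  ∀ P : Pattern A, P.AppearsIn c → ∃ n : ℕ, ∀ M : Pattern A,
    M.domain = Finset.Icc (-(n : ℤ)) n → M.AppearsIn c → P.AppearsInPattern M

/-- The integers `m` such that every pattern of domain `[-n; n]` that appears in `c` appears in
every pattern of domain `[-m; m]` that appears in `c`. -/
def qpBounds {A : Type} (c : ℤ → A) (n : ℕ) : Set ℕ :=
  {m | ∀ P M : Pattern A, P.domain = Finset.Icc (-(n : ℤ)) n → P.AppearsIn c →
    M.domain = Finset.Icc (-(m : ℤ)) m → M.AppearsIn c → P.AppearsInPattern M}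

/-- The quasi-periodicity function of `c`: the smallest such `m`. -/
noncomputable def qpFunction {A : Type} (c : ℤ → A) (n : ℕ) : ℕ :=
  sInf (qpBounds c n)

/-- For a quasi-periodic configuration over a finite alphabet, such an `m` exists, so that
`qpFunction` is a genuine minimum. -/
theorem qpBounds_nonempty {k : ℕ} {c : ℤ → Fin k} (hc : IsQuasiPeriodic c) (n : ℕ) :
    (qpBounds c n).Nonempty := by
  have key : ∀ f : (Finset.Icc (-(n : ℤ)) n) → Fin k, ∃ m : ℕ,
      (Pattern.mk _ f).AppearsIn c → ∀ M : Pattern (Fin k),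
        M.domain = Finset.Icc (-(m : ℤ)) m → M.AppearsIn c →
          (Pattern.mk _ f).AppearsInPattern M := by
    intro f
    by_cases hf : (Pattern.mk _ f).AppearsIn c
    · obtain ⟨m, hm⟩ := hc _ hf
      exact ⟨m, fun _ => hm⟩
    · exact ⟨0, fun h => absurd h hf⟩
  choose g hg using key
  refine ⟨Finset.univ.sup g, ?_⟩
  rintro ⟨D, f⟩ ⟨E, e⟩ hD hP hE ⟨u, hu⟩
  dsimp only at hD hE hu
  subst hD hE
  have hle : g f ≤ Finset.univ.sup g := Finset.le_sup (Finset.mem_univ f)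
  obtain ⟨v, hv⟩ := hg f hP ⟨Finset.Icc (-(g f : ℤ)) (g f), fun x => c (u + x)⟩ rfl
    ⟨u, fun _ => rfl⟩
  refine ⟨v, fun x => ?_⟩
  obtain ⟨h1, h2⟩ := hv x
  have h3 := Finset.mem_Icc.mp h1
  have h4 : v + (x : ℤ) ∈ Finset.Icc (-((Finset.univ.sup g : ℕ) : ℤ)) (Finset.univ.sup g : ℕ) := by
    rw [Finset.mem_Icc]
    omega
  exact ⟨h4, (hu ⟨_, h4⟩).symm.trans h2⟩

end QuasiPeriodicity

open QuasiPeriodicity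

/-! If `φ n = m`, every long enough word whose length codes `n` must contain a factor of length `2 *
n + 1` followed by a gap of more than `2 * m` without recurrence. A window of radius `q < m` placed
in this gap misses the factor, whence the bound (`le_of_mem_qpBounds`). Only non-emptiness needs a
construction, and its witness need not be computable. Cut `ℤ` into blocks of length `2 ^ (2 * k +
1)`, with `2 ^ k` large enough for the bits of `n + 1`. The period-doubling layer reveals the
position inside a block; the data layer writes `n + 1` in the blocks whose index has valuation
`Nat.pair n m`. Equal factors starting at such blocks therefore lie at least `2 ^ (Nat.pair n m + 1)
> 2 * m` apart (`le_sub_of_blockConfiguration_eq`). -/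

/-- Some factor of length `2 * n + 1` of `w` does not reappear at any of the `2 * m` positions
following its own, all of which fit into `w`. -/
def HasIsolatedFactor {A : Type} (n m : ℕ) (w : List A) : Prop :=
  ∃ i < w.length, i + 2 * m + 2 * n + 1 < w.length ∧
    ∀ t < 2 * m, ∃ a < 2 * n + 1, w[i + 1 + t + a]? ≠ w[i + a]?

/-- The length from which on words must have an isolated factor. -/
def isolationLength (R n m : ℕ) : ℕ :=
  (2 * n + R) * 2 ^ Nat.pair n m + 2 * m + 2 * n + 2

/-- The forbidden words: the length of the word codes the argument `n` whose value `m` under `φ`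
requires an isolated factor. -/
def forbiddenWords (A : Type) (R : ℕ) (φ : ℕ →. ℕ) : Set (List A) :=
  {w | ∃ m ∈ φ w.length.unpair.1, isolationLength R w.length.unpair.1 m ≤ w.length ∧
    ¬ HasIsolatedFactor w.length.unpair.1 m w}

/-! ### Enumerability of the forbidden words. -/

section Computability

theorem primrec₂_pow : Primrec₂ ((· ^ ·) : ℕ → ℕ → ℕ) :=
  Primrec₂.unpaired'.1 Nat.Primrec.pow

theorem primrec_isolationLength (R : ℕ) : Primrec₂ (isolationLength R) := by
  have h2 {f : ℕ × ℕ → ℕ} (hf : Primrec f) : Primrec fun p => 2 * f p :=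
    Primrec.nat_mul.comp (Primrec.const 2) hf
  have hc (c : ℕ) : Primrec fun _ : ℕ × ℕ => c := Primrec.const c
  exact Primrec.nat_add.comp (Primrec.nat_add.comp (Primrec.nat_add.comp
    (Primrec.nat_mul.comp (Primrec.nat_add.comp (h2 Primrec.fst) (hc R))
      (primrec₂_pow.comp (hc 2) (Primrec₂.natPair.comp Primrec.fst Primrec.snd)))
    (h2 Primrec.snd)) (h2 Primrec.fst)) (hc 2)

variable {A : Type} [Primcodable A]

theorem PrimrecPred.exists_lt_of {α : Type} [Primcodable α] {f : α → ℕ} {p : α → ℕ → Prop}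
    (hf : Primrec f) (hp : PrimrecPred fun x : ℕ × α => p x.2 x.1) :
    PrimrecPred fun a => ∃ i < f a, p a i :=
  ((PrimrecRel.exists_mem_list (R := fun i a => p a i) hp).comp
    (Primrec.list_range.comp hf) Primrec.id).of_eq fun a => by simp

theorem PrimrecPred.forall_lt_of {α : Type} [Primcodable α] {f : α → ℕ} {p : α → ℕ → Prop}
    (hf : Primrec f) (hp : PrimrecPred fun x : ℕ × α => p x.2 x.1) :
    PrimrecPred fun a => ∀ i < f a, p a i :=
  ((PrimrecRel.forall_mem_list (R := fun i a => p a i) hp).comp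
    (Primrec.list_range.comp hf) Primrec.id).of_eq fun a => by simp

theorem primrecPred_hasIsolatedFactor :
    PrimrecPred fun x : List A × ℕ × ℕ => HasIsolatedFactor x.2.1 x.2.2 x.1 := by
  have h2 {α : Type} [Primcodable α] {f : α → ℕ} (hf : Primrec f) : Primrec fun p => 2 * f p :=
    Primrec.nat_mul.comp (Primrec.const 2) hf
  have hS {α : Type} [Primcodable α] {f : α → ℕ} (hf : Primrec f) : Primrec fun p => f p + 1 :=
    Primrec.succ.comp hf
  refine PrimrecPred.exists_lt_of (Primrec.list_length.comp Primrec.fst) (.and ?_ ?_)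
  · have hw : Primrec fun x : ℕ × List A × ℕ × ℕ => x.2.1 := Primrec.fst.comp Primrec.snd
    have hn : Primrec fun x : ℕ × List A × ℕ × ℕ => x.2.2.1 :=
      Primrec.fst.comp (Primrec.snd.comp Primrec.snd)
    have hm : Primrec fun x : ℕ × List A × ℕ × ℕ => x.2.2.2 :=
      Primrec.snd.comp (Primrec.snd.comp Primrec.snd)
    exact Primrec.nat_lt.comp
      (hS (Primrec.nat_add.comp (Primrec.nat_add.comp Primrec.fst (h2 hm)) (h2 hn)))
      (Primrec.list_length.comp hw)
  · refine PrimrecPred.forall_lt_of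
      (h2 (Primrec.snd.comp (Primrec.snd.comp Primrec.snd))) ?_
    refine PrimrecPred.exists_lt_of (hS (h2 (Primrec.fst.comp
      (Primrec.snd.comp (Primrec.snd.comp Primrec.snd))))) ?_
    have hw : Primrec fun x : ℕ × ℕ × ℕ × List A × ℕ × ℕ => x.2.2.2.1 :=
      Primrec.fst.comp (Primrec.snd.comp (Primrec.snd.comp Primrec.snd))
    have hi : Primrec fun x : ℕ × ℕ × ℕ × List A × ℕ × ℕ => x.2.2.1 :=
      Primrec.fst.comp (Primrec.snd.comp Primrec.snd)
    have ht : Primrec fun x : ℕ × ℕ × ℕ × List A × ℕ × ℕ => x.2.1 :=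
      Primrec.fst.comp Primrec.snd
    exact (Primrec.eq.comp
      (Primrec.list_getElem?.comp hw
        (Primrec.nat_add.comp (Primrec.nat_add.comp (hS hi) ht) Primrec.fst))
      (Primrec.list_getElem?.comp hw (Primrec.nat_add.comp hi Primrec.fst))).not

/-- The length gives `n`; run `φ n`, and if it halts the remaining test is primitive recursive. -/
theorem rePred_forbiddenWords (R : ℕ) {φ : ℕ →. ℕ} (hφ : Partrec φ) :
    REPred fun w => w ∈ forbiddenWords A R φ := by
  have hlen : Primrec fun w : List A => w.length.unpair.1 :=
    Primrec.fst.comp (Primrec.unpair.comp Primrec.list_length)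
  have hbad : PrimrecPred fun x : List A × ℕ =>
      isolationLength R x.1.length.unpair.1 x.2 ≤ x.1.length ∧
        ¬ HasIsolatedFactor x.1.length.unpair.1 x.2 x.1 := by
    refine .and ?_ (.not ?_)
    · exact Primrec.nat_le.comp
        ((primrec_isolationLength R).comp (hlen.comp Primrec.fst) Primrec.snd)
        (Primrec.list_length.comp Primrec.fst)
    · exact primrecPred_hasIsolatedFactor.comp (f := fun x : List A × ℕ =>
        (x.1, x.1.length.unpair.1, x.2))
        (Primrec.fst.pair ((hlen.comp Primrec.fst).pair Primrec.snd))
  have hbad' : REPred _ := ComputablePred.to_re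
    (let ⟨d, h⟩ := hbad; (⟨d, h.to_comp⟩ : ComputablePred _))
  have hpart : Partrec₂ fun (w : List A) (m : ℕ) =>
      Part.assert (isolationLength R w.length.unpair.1 m ≤ w.length ∧
        ¬ HasIsolatedFactor w.length.unpair.1 m w) fun _ => Part.some () := hbad'
  refine (Partrec.dom_re ((hφ.comp hlen.to_comp).bind hpart)).of_eq fun w => ?_
  simp only [forbiddenWords, Part.dom_iff_mem, Part.mem_bind_iff, Part.mem_assert_iff,
    Part.mem_some_iff, Set.mem_ofPred_eq]
  exact ⟨fun ⟨_, m, hm, h, _⟩ => ⟨m, hm, h⟩, fun ⟨m, hm, h⟩ => ⟨(), m, hm, h, trivial⟩⟩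

end Computability

/-! ### From isolated factors to the lower bound. -/

section LowerBound

theorem ofWord_appearsIn_iff {A : Type} {w : List A} {c : ℤ → A} :
    (Pattern.ofWord w).AppearsIn c ↔ ∃ v : ℤ, ∀ j (h : j < w.length), c (v + j) = w[j] := by
  refine exists_congr fun v => ⟨fun h j hj => ?_, fun h x => ?_⟩
  · have := h ⟨j, Finset.mem_Ico.2 ⟨by omega, by omega⟩⟩
    simpa [Pattern.ofWord] using this
  · have hx := Finset.mem_Ico.1 x.2
    have := h (x : ℤ).toNat (by omega)
    rwa [Int.toNat_of_nonneg hx.1] at this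

theorem le_of_mem_qpBounds {A : Type} {c : ℤ → A} {n m q : ℕ} {w : List A} {v : ℤ}
    (hw : ∀ j (h : j < w.length), c (v + j) = w[j]) (hiso : HasIsolatedFactor n m w)
    (hq : q ∈ qpBounds c n) : m ≤ q := by
  by_contra! hlt
  obtain ⟨i, -, hi, H⟩ := hiso
  -- The window of radius `q` starts one cell after the factor, so an occurrence in it has offset `t
  -- ≤ 2 * q - 2 * n < 2 * m`.
  obtain ⟨u, hu⟩ := hq ⟨Finset.Icc (-(n : ℤ)) n, fun x => c (v + i + n + x)⟩
    ⟨Finset.Icc (-(q : ℤ)) q, fun x => c (v + i + 1 + q + x)⟩ rfl ⟨_, fun _ => rfl⟩ rfl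
    ⟨_, fun _ => rfl⟩
  have key (a : ℕ) (ha : a < 2 * n + 1) : ∃ _ : u + (a - n) ∈ Finset.Icc (-(q : ℤ)) q,
      c (v + i + 1 + q + (u + (a - n))) = c (v + i + n + (a - n)) :=
    hu ⟨a - n, Finset.mem_Icc.2 ⟨by omega, by omega⟩⟩
  have hlo := Finset.mem_Icc.1 (key 0 (by omega)).1
  have hhi := Finset.mem_Icc.1 (key (2 * n) (by omega)).1
  push_cast at hlo hhi
  obtain ⟨t, ht⟩ : ∃ t : ℕ, (t : ℤ) = q + u - n := ⟨(q + u - n).toNat, by omega⟩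
  obtain ⟨a, ha, hne⟩ := H t (by omega)
  apply hne
  rw [List.getElem?_eq_getElem (by omega), List.getElem?_eq_getElem (by omega), ← hw, ← hw]
  obtain ⟨-, h⟩ := key a ha
  congr 1
  convert h using 2 <;> push_cast <;> omega

theorem le_qpFunction_of_mem {k R : ℕ} {φ : ℕ →. ℕ} {c : ℤ → Fin k}
    (hc : c ∈ validConfigurations (Pattern.ofWord '' forbiddenWords (Fin k) R φ))
    (hqp : IsQuasiPeriodic c) {n m : ℕ} (hm : m ∈ φ n) : m ≤ qpFunction c n := by
  obtain ⟨w, hlen, hw⟩ : ∃ w : List (Fin k), w.length = Nat.pair n (isolationLength R n m) ∧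
      ∀ j (h : j < w.length), c (0 + j) = w[j] :=
    ⟨List.ofFn fun j : Fin (Nat.pair n (isolationLength R n m)) => c (0 + (j : ℕ)), by simp,
      by simp⟩
  have hn : w.length.unpair.1 = n := by simp [hlen]
  -- Quasi-periodicity serves only here: the infimum of an empty set would be `0`.
  refine le_of_mem_qpBounds hw ?_ (Nat.sInf_mem (qpBounds_nonempty hqp n))
  by_contra hbad
  refine hc _ ⟨w, ⟨m, ?_, ?_, ?_⟩, rfl⟩ (ofWord_appearsIn_iff.2 ⟨0, hw⟩)
  · rwa [hn]
  · rw [hn, hlen]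
    exact Nat.right_le_pair _ _
  · rwa [hn]

end LowerBound

/-! ### 2-adic valuations and the period-doubling sequence. -/

section Valuation

/-- The 2-adic valuation of `i` is exactly `e`. -/
def ExactTwoPow (e : ℕ) (i : ℤ) : Prop := ∃ q : ℤ, i = 2 ^ e * (2 * q + 1)

theorem two_pow_mul_odd_ne {e f : ℕ} (h : e < f) (q r : ℤ) :
    (2 : ℤ) ^ e * (2 * q + 1) ≠ 2 ^ f * r := by
  obtain ⟨d, rfl⟩ := Nat.exists_eq_add_of_lt h
  intro heq
  rw [show (2 : ℤ) ^ (e + d + 1) * r = 2 ^ e * (2 * (2 ^ d * r)) by ring] at heq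
  have := mul_left_cancel₀ (by positivity) heq
  omega

theorem ExactTwoPow.unique {e f : ℕ} {i : ℤ} (he : ExactTwoPow e i) (hf : ExactTwoPow f i) :
    e = f := by
  obtain ⟨q, rfl⟩ := he
  obtain ⟨r, hr⟩ := hf
  rcases lt_trichotomy e f with h | h | h
  · exact absurd hr (two_pow_mul_odd_ne h _ _)
  · exact h
  · exact absurd hr.symm (two_pow_mul_odd_ne h _ _)

theorem exists_exactTwoPow_of_not_dvd {d : ℤ} {J : ℕ} (h : ¬ (2 : ℤ) ^ J ∣ d) :
    ∃ e < J, ExactTwoPow e d := by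
  induction J with
  | zero => simp at h
  | succ J ih =>
    by_cases hJ : (2 : ℤ) ^ J ∣ d
    · obtain ⟨r, rfl⟩ := hJ
      rcases Int.even_or_odd' r with ⟨q, rfl | rfl⟩
      · exact absurd ⟨q, by ring⟩ h
      · exact ⟨J, J.lt_succ_self, q, rfl⟩
    · obtain ⟨e, he, h'⟩ := ih hJ
      exact ⟨e, he.trans J.lt_succ_self, h'⟩

/-- Every window of length `2 ^ (e + 1)` contains an integer of valuation `e`. -/
theorem exists_exactTwoPow_add (e : ℕ) (x : ℤ) :
    ∃ b : ℕ, b < 2 ^ (e + 1) ∧ ExactTwoPow e (x + b) := by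
  have hpos : (0 : ℤ) < 2 ^ (e + 1) := by positivity
  have h0 := Int.emod_nonneg (2 ^ e - x) hpos.ne'
  have h1 := Int.emod_lt_of_pos (2 ^ e - x) hpos
  have h2 := Int.emod_add_mul_ediv (2 ^ e - x) (2 ^ (e + 1))
  refine ⟨((2 ^ e - x) % 2 ^ (e + 1)).toNat, ?_, -((2 ^ e - x) / 2 ^ (e + 1)), ?_⟩
  · zify
    rwa [Int.toNat_of_nonneg h0]
  · rw [Int.toNat_of_nonneg h0]
    rw [pow_succ] at h2 ⊢
    linear_combination h2

/-- The valuation of `i` is even: the period-doubling sequence. -/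
def Ruler (i : ℤ) : Prop := ∃ e, Even e ∧ ExactTwoPow e i

theorem ExactTwoPow.ruler_iff {e : ℕ} {i : ℤ} (h : ExactTwoPow e i) : Ruler i ↔ Even e :=
  ⟨fun ⟨_, hf, h'⟩ => h.unique h' ▸ hf, fun he => ⟨e, he, h⟩⟩

/-- The period-doubling sequence determines the position modulo `2 ^ J` from a window of length
`2 ^ (J + 1)`. -/
theorem two_pow_dvd_sub_of_ruler {J : ℕ} {x y : ℤ}
    (h : ∀ b : ℕ, b < 2 ^ (J + 1) → (Ruler (x + b) ↔ Ruler (y + b))) : (2 : ℤ) ^ J ∣ y - x := by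
  by_contra hd
  obtain ⟨e, he, q, hq⟩ := exists_exactTwoPow_of_not_dvd hd
  -- As `y - x` has valuation `e`, a cell of valuation `e + 1` is matched with one of valuation `e`,
  -- of opposite parity.
  obtain ⟨b, hb, r, hr⟩ := exists_exactTwoPow_add (e + 1) x
  have hy : ExactTwoPow e (y + b) := ⟨q + 2 * r + 1, by
    rw [pow_succ] at hr
    linear_combination hq + hr⟩
  have := h b (hb.trans_le (Nat.pow_le_pow_right two_pos (by omega)))
  rw [ExactTwoPow.ruler_iff ⟨r, hr⟩, hy.ruler_iff, Nat.even_add_one] at this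
  tauto

end Valuation

/-! ### A configuration without forbidden words. -/

section Configuration

/-- The data layer: the cells of valuation `k` of the `Q`-th block of length `2 ^ (2 * k + 1)`
hold the binary digits of `n + 1` whenever the valuation of `Q` codes a pair `(n, φ n)`. -/
def DataBit (φ : ℕ →. ℕ) (i : ℤ) : Prop :=
  ∃ k r n m : ℕ, ∃ Q : ℤ, r < 2 ^ k ∧ n + 1 < 2 ^ 2 ^ k ∧ m ∈ φ n ∧ ExactTwoPow (Nat.pair n m) Q ∧
    (n + 1).testBit r ∧ i = 2 ^ (2 * k + 1) * Q + 2 ^ k * (2 * r + 1)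

/-- The valuation of the cell is `k`, and division by `2 ^ k` then separates `Q` from `r`. Hence all
levels share one layer without conflict. -/
theorem dataCell_injective {k k' r r' : ℕ} {Q Q' : ℤ} (hr : r < 2 ^ k) (hr' : r' < 2 ^ k')
    (h : (2 : ℤ) ^ (2 * k + 1) * Q + 2 ^ k * (2 * r + 1) =
      2 ^ (2 * k' + 1) * Q' + 2 ^ k' * (2 * r' + 1)) : k = k' ∧ r = r' ∧ Q = Q' := by
  have e (k r : ℕ) (Q : ℤ) : (2 : ℤ) ^ (2 * k + 1) * Q + 2 ^ k * (2 * r + 1) =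
      2 ^ k * (2 * (2 ^ k * Q + r) + 1) := by ring
  rw [e, e] at h
  obtain rfl : k = k' := ExactTwoPow.unique ⟨_, rfl⟩ ⟨_, h⟩
  have h1 := mul_left_cancel₀ (by positivity) h
  have hpos : (0 : ℤ) < 2 ^ k := by positivity
  zify at hr hr'
  have h2 : (2 : ℤ) ^ k * Q + r = 2 ^ k * Q' + r' := by omega
  have hQ : Q = Q' := by
    have := congrArg (· / (2 : ℤ) ^ k) h2
    simpa [Int.add_comm (2 ^ k * _), Int.add_mul_ediv_left _ _ hpos.ne',
      Int.ediv_eq_zero_of_lt, hr, hr'] using this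
  subst hQ
  exact ⟨rfl, by omega, rfl⟩

theorem dataBit_iff {φ : ℕ →. ℕ} {k r n m : ℕ} {Q : ℤ} (hr : r < 2 ^ k) (hn : n + 1 < 2 ^ 2 ^ k)
    (hm : m ∈ φ n) (hQ : ExactTwoPow (Nat.pair n m) Q) :
    DataBit φ (2 ^ (2 * k + 1) * Q + 2 ^ k * (2 * r + 1)) ↔ (n + 1).testBit r := by
  constructor
  · rintro ⟨k', r', n', m', Q', hr', -, -, hQ', hb, h⟩
    obtain ⟨rfl, rfl, rfl⟩ := dataCell_injective hr hr' h
    obtain ⟨rfl, rfl⟩ := Nat.pair_eq_pair.1 (hQ.unique hQ')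
    exact hb
  · exact fun hb => ⟨k, r, n, m, Q, hr, hn, hm, hQ, hb, rfl⟩

/-- Blocks with the same data as a block that codes `(n, φ n)` code the same pair. -/
theorem exactTwoPow_of_dataBit {φ : ℕ →. ℕ} {k n m : ℕ} {Q Q' : ℤ} (hn : n + 1 < 2 ^ 2 ^ k)
    (hm : m ∈ φ n) (hQ : ExactTwoPow (Nat.pair n m) Q)
    (h : ∀ r : ℕ, r < 2 ^ k → (DataBit φ (2 ^ (2 * k + 1) * Q + 2 ^ k * (2 * r + 1)) ↔
      DataBit φ (2 ^ (2 * k + 1) * Q' + 2 ^ k * (2 * r + 1)))) :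
    ExactTwoPow (Nat.pair n m) Q' := by
  -- Storing `n + 1` guarantees a set bit, which a block coding nothing lacks.
  obtain ⟨r, hr⟩ := Nat.exists_testBit_of_ne_zero n.succ_ne_zero
  have hrk : r < 2 ^ k := by
    by_contra! hle
    rw [Nat.testBit_lt_two_pow (hn.trans_le (Nat.pow_le_pow_right two_pos hle))] at hr
    cases hr
  obtain ⟨k', r', n', m', Q'', hr', hn', hm', hQ', -, heq⟩ :=
    (h r hrk).1 ((dataBit_iff hrk hn hm hQ).2 hr)
  obtain ⟨rfl, rfl, rfl⟩ := dataCell_injective hrk hr' heq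
  have hnn : n + 1 = n' + 1 := by
    refine Nat.eq_of_testBit_eq fun j => ?_
    by_cases hj : j < 2 ^ k
    · have := h j hj
      rw [dataBit_iff hj hn hm hQ, dataBit_iff hj hn' hm' hQ'] at this
      exact Bool.eq_iff_iff.2 this
    · have hj' := Nat.pow_le_pow_right two_pos (not_lt.1 hj)
      rw [Nat.testBit_lt_two_pow (hn.trans_le hj'), Nat.testBit_lt_two_pow (hn'.trans_le hj')]
  obtain rfl : n = n' := by omega
  rwa [Part.mem_unique hm hm']

open Classical in
/-- The configuration whose cell `i` holds the period-doubling and data layers on `[i, i + R)`. -/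
noncomputable def blockConfiguration (R : ℕ) (φ : ℕ →. ℕ) (i : ℤ) : Fin R → Bool × Bool :=
  fun j => (decide (Ruler (i + (j : ℕ))), decide (DataBit φ (i + (j : ℕ))))

theorem layers_eq_of_blockConfiguration_eq {R n : ℕ} {φ : ℕ →. ℕ} {x y : ℤ}
    (hR : 0 < R)
    (h : ∀ a : ℕ, a < 2 * n + 1 → blockConfiguration R φ (x + a) = blockConfiguration R φ (y + a))
    {b : ℕ} (hb : b < 2 * n + R) :
    (Ruler (x + b) ↔ Ruler (y + b)) ∧ (DataBit φ (x + b) ↔ DataBit φ (y + b)) := by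
  obtain ⟨a, j, ha, hj, rfl⟩ : ∃ a j, a < 2 * n + 1 ∧ j < R ∧ b = a + j := by
    by_cases hb' : b ≤ 2 * n
    · exact ⟨b, 0, by omega, hR, rfl⟩
    · exact ⟨2 * n, b - 2 * n, by omega, by omega, by omega⟩
  have := congrFun (h a ha) ⟨j, hj⟩
  simpa [blockConfiguration, add_assoc] using this

/-- The period-doubling layer puts `y` at a block boundary, and the data give its block index the
valuation of `Q`. Distinct integers of valuation `e` differ by a multiple of `2 ^ (e + 1)`. -/
theorem le_sub_of_blockConfiguration_eq {R k n m : ℕ} {φ : ℕ →. ℕ} {Q y : ℤ}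
    (hR : 0 < R) (hk : 2 ^ (2 * k + 2) ≤ 2 * n + R) (hn : n + 1 < 2 ^ 2 ^ k) (hm : m ∈ φ n)
    (hQ : ExactTwoPow (Nat.pair n m) Q)
    (h : ∀ a : ℕ, a < 2 * n + 1 → blockConfiguration R φ (2 ^ (2 * k + 1) * Q + a) =
      blockConfiguration R φ (y + a))
    (hy : 2 ^ (2 * k + 1) * Q < y) :
    (2 : ℤ) ^ (2 * k + 1) * 2 ^ (Nat.pair n m + 1) ≤ y - 2 ^ (2 * k + 1) * Q := by
  obtain ⟨d, hd⟩ := two_pow_dvd_sub_of_ruler (J := 2 * k + 1) fun b hb =>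
    (layers_eq_of_blockConfiguration_eq hR h (hb.trans_le hk)).1
  obtain rfl : y = 2 ^ (2 * k + 1) * (Q + d) := by linear_combination hd
  have hQ' : ExactTwoPow (Nat.pair n m) (Q + d) := by
    refine exactTwoPow_of_dataBit hn hm hQ fun r hr => ?_
    have hb : 2 ^ k * (2 * r + 1) < 2 * n + R := by
      refine lt_of_lt_of_le ?_ hk
      calc 2 ^ k * (2 * r + 1) < 2 ^ k * (2 * 2 ^ k) := by gcongr; omega
        _ ≤ 2 ^ (2 * k + 2) := by
          rw [show 2 ^ (2 * k + 2) = 2 * (2 ^ k * (2 * 2 ^ k)) by ring]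
          omega
    simpa using (layers_eq_of_blockConfiguration_eq hR h hb).2
  obtain ⟨q, rfl⟩ := hQ
  obtain ⟨q', hq'⟩ := hQ'
  obtain rfl : d = 2 ^ (Nat.pair n m + 1) * (q' - q) := by
    rw [pow_succ]
    linear_combination hq'
  rw [hd]
  have h1 : 0 < q' - q := by
    have : (0 : ℤ) < 2 ^ (2 * k + 1) * (2 ^ (Nat.pair n m + 1) * (q' - q)) := by
      rw [← hd]
      exact sub_pos.2 hy
    exact pos_of_mul_pos_right (pos_of_mul_pos_right this (by positivity)) (by positivity)
  gcongr
  exact le_mul_of_one_le_right (by positivity) h1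

/-- For the least `k`, `2 ^ (2 * k + 2)` is polylogarithmic in `n`; the constant `1024 = 2 ^ 10`
absorbs the levels `k ≤ 4`. -/
theorem exists_level (n : ℕ) : ∃ k, n + 1 < 2 ^ 2 ^ k ∧ 2 ^ (2 * k + 2) ≤ 2 * n + 1024 := by
  have hex : ∃ k, n + 1 < 2 ^ 2 ^ k :=
    ⟨n + 1, (Nat.lt_two_pow_self).trans (Nat.pow_lt_pow_right one_lt_two Nat.lt_two_pow_self)⟩
  refine ⟨Nat.find hex, Nat.find_spec hex, ?_⟩
  rcases hk : Nat.find hex with _ | j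
  · norm_num
  · have hj : 2 ^ 2 ^ j ≤ n + 1 := not_lt.1 (Nat.find_min hex (by omega))
    rcases lt_or_ge j 4 with h4 | h4
    · interval_cases j <;> norm_num
    · have hexp : 2 * j + 3 ≤ 2 ^ j := by
        clear hj hk
        induction j, h4 using Nat.le_induction with
        | base => norm_num
        | succ j hj4 ih =>
          rw [pow_succ]
          omega
      calc 2 ^ (2 * (j + 1) + 2) = 2 * 2 ^ (2 * j + 3) := by ring
        _ ≤ 2 * 2 ^ 2 ^ j := by gcongr; norm_num
        _ ≤ 2 * n + 1024 := by omega

theorem hasIsolatedFactor_of_blockConfiguration {A : Type} {φ : ℕ →. ℕ} {n m : ℕ} {w : List A}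
    {f : (Fin 1024 → Bool × Bool) → A} (hf : f.Injective) {v : ℤ}
    (hw : ∀ j (h : j < w.length), f (blockConfiguration 1024 φ (v + j)) = w[j]) (hm : m ∈ φ n)
    (hlen : isolationLength 1024 n m ≤ w.length) : HasIsolatedFactor n m w := by
  obtain ⟨k, hn, hk⟩ := exists_level n
  -- Such a position starts a block whose index has valuation `Nat.pair n m`.
  obtain ⟨i, hi, q, hq⟩ := exists_exactTwoPow_add (2 * k + 1 + Nat.pair n m) v
  have hQ : v + i = 2 ^ (2 * k + 1) * (2 ^ Nat.pair n m * (2 * q + 1)) := by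
    rw [hq]
    ring
  have hi' : i < (2 * n + 1024) * 2 ^ Nat.pair n m := by
    refine hi.trans_le ?_
    rw [show 2 ^ (2 * k + 1 + Nat.pair n m + 1) = 2 ^ (2 * k + 2) * 2 ^ Nat.pair n m by ring]
    exact Nat.mul_le_mul_right _ hk
  unfold isolationLength at hlen
  refine ⟨i, by omega, by omega, fun t ht => ?_⟩
  by_contra! hall
  have hgap := le_sub_of_blockConfiguration_eq (y := v + i + 1 + t) (by norm_num) hk hn hm ⟨q, rfl⟩
    (fun a ha => ?_) (by rw [← hQ]; omega)
  · have hm2 : m < 2 ^ Nat.pair n m := (Nat.right_le_pair n m).trans_lt Nat.lt_two_pow_self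
    zify at hm2
    have h1 : (2 : ℤ) ^ (Nat.pair n m + 1) ≤ 2 ^ (2 * k + 1) * 2 ^ (Nat.pair n m + 1) :=
      le_mul_of_one_le_left (by positivity) (one_le_pow₀ (by norm_num))
    have h2 := h1.trans hgap
    rw [← hQ, pow_succ] at h2
    omega
  · have h := hall a ha
    rw [List.getElem?_eq_getElem (by omega), List.getElem?_eq_getElem (by omega), ← hw, ← hw,
      Option.some_inj] at h
    rw [← hQ]
    have := (hf h).symm
    push_cast at this
    convert this using 2 <;> ring

end Configuration

theorem theorem2 (φ : ℕ →. ℕ) (hφ : Partrec φ) :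
    ∃ (k : ℕ) (X : Set (ℤ → Fin k)),
      QuasiPeriodicity.IsEffectiveSubshift X ∧ X.Nonempty ∧
        ∀ c ∈ X, QuasiPeriodicity.IsQuasiPeriodic c →
          ∀ n m : ℕ, m ∈ φ n → m ≤ QuasiPeriodicity.qpFunction c n := by
  refine ⟨_, _, ⟨forbiddenWords _ 1024 φ, rePred_forbiddenWords 1024 hφ, rfl⟩,
    ⟨fun i => Fintype.equivFin (Fin 1024 → Bool × Bool) (blockConfiguration 1024 φ i), ?_⟩,
    fun c hc hqp n m hm => le_qpFunction_of_mem hc hqp hm⟩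
  rintro _ ⟨w, ⟨m, hm, hlen, hbad⟩, rfl⟩ happ
  obtain ⟨v, hv⟩ := ofWord_appearsIn_iff.1 happ
  exact hbad (hasIsolatedFactor_of_blockConfiguration (Equiv.injective _) hv hm hlen)
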